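/- Let $S$ (states) and $A$ (actions) be Borel spaces, i.e. non-empty Borel subsets of complete separable metric spaces. For each $s\in S$ let $A(s)\subset A$ be a non-empty set such that $\mathbb K=\{(s,a): s\in S,\ a\in A(s)\}$ is Borel in $S\times A$. Let $p$ be a transition probability from $\mathbb K$ to $S$, $\mu$ a probability measure on $S$, $\beta\in(0,1)$, and let $r_0,\dots,r_m:\mathbb K\to[-\infty,\infty)$ be Borel measurable. A policy $\pi=(\pi_n)_{n\ge1}$ is a sequence of transition probabilities $\pi_n$ from the set $H_n=\mathbb K^{n-1}\times S$ of histories $h_n=(s_1,a_1,\dots,s_{n-1},a_{n-1},s_n)$ to $A$ with $\pi_n(A(s_n)\mid h_n)=1$ for all $h_n\in H_n$; $\Pi$ is the set of all policies. For $\pi\in\Pi$ let $P^\pi_\mu$ be the strategic measure on $\Omega=(S\times A)^\infty$, i.e. the law of $(s_1,a_1,s_2,a_2,\dots)$ under which $s_1$ has law $\mu$, the conditional law of $a_n$ given $h_n$ is $\pi_n(\cdot\mid h_n)$, and the conditional law of $s_{n+1}$ given $(h_n,a_n)$ is $p(\cdot\mid s_n,a_n)$; it is carried by $\mathbb K^\infty$,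 and $E^\pi_\mu$ denotes its expectation. Let $\mathcal P=\{P^\pi_\mu:\pi\in\Pi\}$ carry the topology of weak convergence of probability measures on $\Omega$. Assume that there is a Borel function $w:S\to[1,\infty)$ with (A1) $r_i(s,a)\le w(s)$ for all $(s,a)\in\mathbb K$ and $i=0,\dots,m$; (A2) $\displaystyle\lim_{n\to\infty}\sup_{\pi\in\Pi}E^\pi_\mu\Big(\sum_{k=n}^\infty\beta^{k-1}w(s_k)\Big)=0$, and $\displaystyle\lim_{l\to\infty}\sup_{\pi\in\Pi}E^\pi_\mu\big(w(s_n)1_{\{w(s_n)\ge l\}}\big)=0$ for every $n\ge1$; and that either (W1)–(W3) or (S1)–(S3) hold: (W1) every $A(s)$ is compact, and $\{s: A(s)\cap B\neq\emptyset\}$ is closed for every closed $B\subset A$; (W2) $(s,a)\mapsto\int_S v(t)\,p(dt\mid s,a)$ is continuous on $\mathbb K$ for every bounded continuous $v:S\to\mathbb R$; (W3) every $r_i$ is upper semicontinuous on $\mathbb K$; (S1) every $A(s)$ is compact; (S2) $a\mapsto p(D\mid s,a)$ is continuous on $A(s)$ for every $s\in S$ and every Borel $D\subset S$; (S3) $r_i(s,\cdot)$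 is upper semicontinuous on $A(s)$ for every $i$ and $s$. Then, for every $i\in\{0,\dots,m\}$, the discounted reward functional $$J_i(P^\pi_\mu)=E^\pi_\mu\Big(\sum_{n=1}^\infty\beta^{n-1}r_i(s_n,a_n)\Big)$$ is well defined on $\mathcal P$ with values in $[-\infty,\infty)$ (indeed $E^\pi_\mu\big(\sum_{n=1}^\infty\beta^{n-1}\max\{r_i(s_n,a_n),0\}\big)<\infty$ for every $\pi\in\Pi$), and $J_i:\mathcal P\to[-\infty,\infty)$ is upper semicontinuous. -/

import Mathlib

open MeasureTheory ProbabilityTheory Filter Topology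
open scoped ENNReal BoundedContinuousFunction

universe u v

/-- A Borel space: a nonempty topological space that is (homeomorphic to) a Borel subset of a
complete separable metric space, with its Borel sigma-algebra. -/
class BorelSubspaceOfPolish (Y : Type u) [TopologicalSpace Y] [MeasurableSpace Y] : Prop
    extends BorelSpace Y where
  nonempty : Nonempty Y
  exists_embedding : ∃ (Z : Type u) (_ : TopologicalSpace Z) (_ : PolishSpace Z) (f : Y → Z),
    IsEmbedding f ∧ MeasurableSet[borel Z] (Set.range f)

/-- Second countability is needed for the Borel sigma-algebra of a countable product of Borel
spaces to be the product sigma-algebra. -/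
instance BorelSubspaceOfPolish.secondCountableTopology (Y : Type u) [TopologicalSpace Y]
    [MeasurableSpace Y] [h : BorelSubspaceOfPolish Y] : SecondCountableTopology Y := by
  obtain ⟨Z, _, _, f, hf, _⟩ := h.exists_embedding
  exact hf.secondCountableTopology

noncomputable section

/-- A constrained Markov decision process with state space `S`, action space `A`, and reward
functions `r 0, …, r m` (`r 0` is the stage reward, the others are the sources of constraints). -/
structure CMDP (S : Type u) (A : Type v) [MeasurableSpace S] [MeasurableSpace A] (m : ℕ) where
  /-- the set of actions available in a state -/
  act : S → Set A
  act_nonempty : ∀ s, (act s).Nonempty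
  measurableSet_graph : MeasurableSet {x : S × A | x.2 ∈ act x.1}
  /-- the transition probability from feasible state-action pairs to states -/
  p : Kernel {x : S × A // x.2 ∈ act x.1} S
  isMarkovKernel_p : IsMarkovKernel p
  /-- the initial distribution -/
  μ : Measure S
  isProbabilityMeasure_μ : IsProbabilityMeasure μ
  /-- the reward functions, with values in `[-∞, ∞)` -/
  r : Fin (m + 1) → {x : S × A // x.2 ∈ act x.1} → EReal
  measurable_r : ∀ i, Measurable (r i)
  r_ne_top : ∀ i k, r i k ≠ ⊤
  /-- the discount factor -/
  β : ℝ
  β_pos : 0 < β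
  β_lt_one : β < 1

namespace CMDP

section Measurable

variable {S : Type u} {A : Type v} [MeasurableSpace S] [MeasurableSpace A] {m : ℕ}

/-- The space of feasible state-action pairs. -/
abbrev K (M : CMDP S A m) : Type (max u v) := {x : S × A // x.2 ∈ M.act x.1}

/-- The space of partial histories `(s₀, a₀, …, s_{n-1}, a_{n-1}, s_n)`; time starts at `0`. -/
abbrev H (M : CMDP S A m) (n : ℕ) : Type (max u v) := (Fin n → M.K) × S

/-- A (randomized, history dependent) policy. -/
structure Policy (M : CMDP S A m) where
  /-- the conditional distribution of the action `a_n` given the partial history -/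
  kernel : ∀ n, Kernel (M.H n) A
  isMarkovKernel : ∀ n, IsMarkovKernel (kernel n)
  feasible : ∀ n (h : M.H n), kernel n h (M.act h.2) = 1

/-- The first `n` state-action pairs of a feasible trajectory. -/
def past (M : CMDP S A m) (n : ℕ) (ω : ℕ → M.K) : Fin n → M.K := fun i => ω i

/-- The partial history of a feasible trajectory at time `n`. -/
def hist (M : CMDP S A m) (n : ℕ) (ω : ℕ → M.K) : M.H n := (M.past n ω, (ω n).1.1)

/-- `Q` is the law on the space of feasible trajectories under the policy `π`:
`s₀` has law `μ`, the conditional law of `a_n` given the history `h_n` is `π_n(· | h_n)`, and the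
conditional law of `s_{n+1}` given `(h_n, a_n)` is `p(· | s_n, a_n)`. -/
structure IsTrajectoryLaw (M : CMDP S A m) (π : M.Policy) (Q : Measure (ℕ → M.K)) : Prop where
  initial : Q.map (fun ω => (ω 0).1.1) = M.μ
  action : ∀ n, Q.map (fun ω => (M.hist n ω, (ω n).1.2)) = (Q.map (M.hist n)) ⊗ₘ (π.kernel n)
  transition : ∀ n, Q.map (fun ω => (M.past (n + 1) ω, (ω (n + 1)).1.1)) =
    (Q.map (M.past (n + 1))) ⊗ₘ
      (M.p.comap (fun k : Fin (n + 1) → M.K => k (Fin.last n)) (measurable_pi_apply _))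

/-- `P` is the strategic measure on `(S × A)^∞` of the policy `π` (and the initial distribution):
it is the image of the law on feasible trajectories. -/
def IsStrategicMeasure (M : CMDP S A m) (π : M.Policy)
    (P : ProbabilityMeasure (ℕ → S × A)) : Prop :=
  ∃ Q : Measure (ℕ → M.K), M.IsTrajectoryLaw π Q ∧
    (P : Measure (ℕ → S × A)) = Q.map (fun ω n => (ω n).1)

/-- The set of all strategic measures. -/
def strategicMeasures (M : CMDP S A m) : Set (ProbabilityMeasure (ℕ → S × A)) :=
  {P | ∃ π : M.Policy, M.IsStrategicMeasure π P}

open Classical in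
/-- The reward function as a function on `S × A`. The value `0` at infeasible pairs is immaterial,
because strategic measures are carried by feasible trajectories. -/
def reward (M : CMDP S A m) (i : Fin (m + 1)) (x : S × A) : EReal :=
  if h : x.2 ∈ M.act x.1 then M.r i ⟨x, h⟩ else 0

/-- The expectation of an extended real function: the difference of the expectations of its
positive and its negative part (it is well defined if one of them is finite). -/
def expect {Ω : Type*} [MeasurableSpace Ω] (P : Measure Ω) (f : Ω → EReal) : EReal :=
  ((∫⁻ ω, (f ω).toENNReal ∂P : ℝ≥0∞) : EReal) - ((∫⁻ ω, (-f ω).toENNReal ∂P : ℝ≥0∞) : EReal)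

/-- The expected total discounted reward `J_i`, as a function of the strategic measure. -/
def J (M : CMDP S A m) (i : Fin (m + 1)) (P : ProbabilityMeasure (ℕ → S × A)) : EReal :=
  expect (P : Measure (ℕ → S × A))
    (fun ω => ∑' n : ℕ, ((M.β ^ n : ℝ) : EReal) * M.reward i (ω n))

/-- The expected total discounted positive part of the reward. -/
def Jpos (M : CMDP S A m) (i : Fin (m + 1)) (P : ProbabilityMeasure (ℕ → S × A)) : ℝ≥0∞ :=
  ∫⁻ ω, ∑' n : ℕ, ENNReal.ofReal (M.β ^ n) * (M.reward i (ω n)).toENNReal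
    ∂(P : Measure (ℕ → S × A))

/-- `w` is a Borel function with values in `[1, ∞)` and dominates the rewards from above. -/
structure IsUpperBound (M : CMDP S A m) (w : S → ℝ) : Prop where
  measurable : Measurable w
  one_le : ∀ s, 1 ≤ w s
  r_le : ∀ i (k : M.K), M.r i k ≤ (w k.1.1 : EReal)

/-- The expected discounted tails of `w` tend to zero uniformly over all policies, and `w(s_n)` is
uniformly integrable with respect to the strategic measures, for every `n`. -/
structure UniformlyIntegrable (M : CMDP S A m) (w : S → ℝ) : Prop where
  tail : Tendsto (fun n : ℕ => ⨆ P ∈ M.strategicMeasures,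
    ∫⁻ ω, ∑' k : ℕ, ENNReal.ofReal (M.β ^ (n + k) * w (ω (n + k)).1)
      ∂(P : Measure (ℕ → S × A))) atTop (𝓝 0)
  unifInt : ∀ n : ℕ, Tendsto (fun l : ℕ => ⨆ P ∈ M.strategicMeasures,
    ∫⁻ ω, ({s : S | (l : ℝ) ≤ w s}.indicator (fun s => ENNReal.ofReal (w s))) (ω n).1
      ∂(P : Measure (ℕ → S × A))) atTop (𝓝 0)

end Measurable

section Topological

variable {S : Type u} {A : Type v} [MeasurableSpace S] [MeasurableSpace A]
  [TopologicalSpace S] [TopologicalSpace A] {m : ℕ}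

/-- Model with weakly continuous transitions. -/
structure IsWeaklyContinuous (M : CMDP S A m) : Prop where
  isCompact_act : ∀ s, IsCompact (M.act s)
  /-- upper semicontinuity of the correspondence of available actions -/
  isClosed_act : ∀ B : Set A, IsClosed B → IsClosed {s | (M.act s ∩ B).Nonempty}
  continuous_p : ∀ f : S →ᵇ ℝ, Continuous (fun k : M.K => ∫ t, f t ∂(M.p k))
  usc_r : ∀ i, UpperSemicontinuous (M.r i)

/-- Model with setwise continuous transitions. -/
structure IsSetwiseContinuous (M : CMDP S A m) : Prop where
  isCompact_act : ∀ s, IsCompact (M.act s)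
  continuous_p : ∀ (s : S) (D : Set S), MeasurableSet D →
    Continuous (fun a : M.act s => M.p ⟨(s, a.1), a.2⟩ D)
  usc_r : ∀ i (s : S), UpperSemicontinuous (fun a : M.act s => M.r i ⟨(s, a.1), a.2⟩)

end Topological

end CMDP

end

/-!
Truncate the reward at a level `l`: it is `(l + excess) - shortfall`. By (A1) and (A2) the expected
discounted excess is small uniformly over all strategic measures, so `J` is a uniform limit of
functions of the form constant minus expected discounted shortfall, and it suffices that the
expected shortfall at each time `n` is lower semicontinuous. By the layer cake formula and Fatou's
lemma this reduces to `Q O ≤ liminf Qₖ O` for the superlevel sets `O` of the shortfall, where `Qₖ`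
and `Q` are the laws of `(s_n, a_n)`.

For weakly continuous transitions `O` is relatively open in the set of feasible pairs and this is
the portmanteau theorem. For setwise continuous transitions only the sections of `O` over `S` are
relatively open. Disintegrating a measure that dominates all `Qₖ` replaces `O` by a countable union
of rectangles `E × B` with `E` measurable and `B` open. If the state marginals converge setwise,
outer regularity makes the `E` open up to a small error and the portmanteau theorem applies again.
That the state marginals converge setwise follows by induction on `n`, applying the same inequality
to the transition probabilities.
-/

section ExtendedReal

variable {Ω : Type*} [MeasurableSpace Ω]

theorem ereal_coe_sub_add_coe_sub (a b c d : ℝ≥0∞) :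
    ((a : EReal) - b) + (c - d) = ((a + c : ℝ≥0∞) : EReal) - ((b + d : ℝ≥0∞) : EReal) := by
  rw [EReal.coe_ennreal_add, EReal.coe_ennreal_add, sub_eq_add_neg _ (_ + _),
    EReal.neg_add (.inl (EReal.coe_ennreal_ne_bot b)) (.inr (EReal.coe_ennreal_ne_bot d)),
    sub_eq_add_neg, sub_eq_add_neg, sub_eq_add_neg]
  exact add_add_add_comm _ _ _ _

theorem ereal_sum_coe_sub {ι : Type*} (a b : ι → ℝ≥0∞) (s : Finset ι) :
    ∑ n ∈ s, ((a n : EReal) - b n) =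
      ((∑ n ∈ s, a n : ℝ≥0∞) : EReal) - ((∑ n ∈ s, b n : ℝ≥0∞) : EReal) := by
  induction s using Finset.cons_induction with
  | empty => simp
  | cons n s hn ih => simp only [Finset.sum_cons, ih, ereal_coe_sub_add_coe_sub]

theorem ereal_tsum_coe_sub {ι : Type*} {a b : ι → ℝ≥0∞} (ha : ∑' n, a n ≠ ⊤) :
    ∑' n, ((a n : EReal) - b n) =
      ((∑' n, a n : ℝ≥0∞) : EReal) - ((∑' n, b n : ℝ≥0∞) : EReal) := by
  have tendsto_sum_coe (c : ι → ℝ≥0∞) :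
      Tendsto (fun s => ((∑ n ∈ s, c n : ℝ≥0∞) : EReal)) atTop (𝓝 ((∑' n, c n : ℝ≥0∞) : EReal)) :=
    (continuous_coe_ennreal_ereal.tendsto _).comp ENNReal.summable.hasSum
  have tendsto_sub : Tendsto
      (fun s => ((∑ n ∈ s, a n : ℝ≥0∞) : EReal) - ((∑ n ∈ s, b n : ℝ≥0∞) : EReal)) atTop
      (𝓝 (((∑' n, a n : ℝ≥0∞) : EReal) - ((∑' n, b n : ℝ≥0∞) : EReal))) :=
    (EReal.continuousAt_add (.inl (by simpa using ha))
      (.inl (EReal.coe_ennreal_ne_bot _))).tendsto.comp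
        ((tendsto_sum_coe a).prodMk_nhds ((continuous_neg.tendsto _).comp (tendsto_sum_coe b)))
  exact HasSum.tsum_eq (tendsto_sub.congr fun s => (ereal_sum_coe_sub a b s).symm)

theorem ereal_eq_natCast_add_toENNReal_sub (x : EReal) (l : ℕ) :
    x = ((l + (x - l).toENNReal : ℝ≥0∞) : EReal) - ((l - x).toENNReal : EReal) := by
  have natCast_eq : (l : EReal) = ((l : ℝ) : EReal) := rfl
  have coe_natCast : ((l : ℝ≥0∞) : EReal) = l := rfl
  rw [EReal.coe_ennreal_add, coe_natCast]
  rcases le_total x l with h | h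
  · rw [EReal.toENNReal_of_nonpos (EReal.sub_nonpos.2 h), EReal.coe_ennreal_zero, add_zero,
      EReal.coe_toENNReal ((EReal.sub_nonneg (.inl (EReal.natCast_ne_top l))
        (.inl (EReal.natCast_ne_bot l))).2 h), natCast_eq]
    induction x with
    | bot => rw [EReal.coe_sub_bot, EReal.sub_top]
    | top => exact absurd (top_le_iff.1 h) (EReal.natCast_ne_top l)
    | coe x => norm_cast; ring
  · rw [EReal.toENNReal_of_nonpos (EReal.sub_nonpos.2 h), EReal.coe_ennreal_zero, sub_zero,
      EReal.coe_toENNReal ((EReal.sub_nonneg (.inr (EReal.natCast_ne_top l))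
        (.inr (EReal.natCast_ne_bot l))).2 h), add_comm, natCast_eq, EReal.sub_add_cancel]

theorem ereal_sub_coe_le_self (x : EReal) (c : ℝ≥0∞) : x - c ≤ x :=
  EReal.sub_le_of_le_add (le_add_of_nonneg_right (EReal.coe_ennreal_nonneg c))

theorem ereal_coe_mul_coe_sub {b : ℝ} (hb : 0 ≤ b) (x y : ℝ≥0∞) :
    (b : EReal) * ((x : EReal) - y) =
      ((ENNReal.ofReal b * x : ℝ≥0∞) : EReal) - ((ENNReal.ofReal b * y : ℝ≥0∞) : EReal) := by
  rw [EReal.mul_sub_of_nonneg_of_ne_top (EReal.coe_nonneg.2 hb) (EReal.coe_ne_top b),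
    EReal.coe_ennreal_mul, EReal.coe_ennreal_mul, EReal.coe_ennreal_ofReal, max_eq_left hb]

theorem expect_congr_ae {P : Measure Ω} {f g : Ω → EReal} (h : f =ᵐ[P] g) :
    CMDP.expect P f = CMDP.expect P g := by
  have pos_part : ∫⁻ ω, (f ω).toENNReal ∂P = ∫⁻ ω, (g ω).toENNReal ∂P :=
    lintegral_congr_ae (h.fun_comp EReal.toENNReal)
  have neg_part : ∫⁻ ω, (-f ω).toENNReal ∂P = ∫⁻ ω, (-g ω).toENNReal ∂P :=
    lintegral_congr_ae (h.fun_comp fun x => (-x).toENNReal)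
  rw [CMDP.expect, CMDP.expect, pos_part, neg_part]

theorem expect_coe_sub {P : Measure Ω} {a b : Ω → ℝ≥0∞} (ha : Measurable a) (hb : Measurable b)
    (hfin : ∫⁻ ω, a ω ∂P ≠ ⊤) :
    CMDP.expect P (fun ω => (a ω : EReal) - b ω) =
      ((∫⁻ ω, a ω ∂P : ℝ≥0∞) : EReal) - ((∫⁻ ω, b ω ∂P : ℝ≥0∞) : EReal) := by
  have toENNReal_coe_sub (x y : ℝ≥0∞) : ((x : EReal) - y).toENNReal = x - y := by
    rw [EReal.toENNReal_sub (EReal.coe_ennreal_nonneg y), EReal.toENNReal_coe,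
      EReal.toENNReal_coe]
  have neg_part : ∀ᵐ ω ∂P, (-((a ω : EReal) - b ω)).toENNReal = b ω - a ω := by
    filter_upwards [ae_lt_top ha hfin] with ω hω
    rw [EReal.neg_sub (.inl (EReal.coe_ennreal_ne_bot _)) (.inl (by simpa using hω.ne)),
      add_comm, ← sub_eq_add_neg, toENNReal_coe_sub]
  -- Both integrands are truncated differences; adding `min a b` to them restores `a` and `b`.
  have min_ne_top : ∫⁻ ω, min (a ω) (b ω) ∂P ≠ ⊤ :=
    ne_top_of_le_ne_top hfin (lintegral_mono fun ω => min_le_left _ _)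
  have sub_self_min : ((∫⁻ ω, min (a ω) (b ω) ∂P : ℝ≥0∞) : EReal) -
      ((∫⁻ ω, min (a ω) (b ω) ∂P : ℝ≥0∞) : EReal) = 0 :=
    EReal.sub_self (by simpa using min_ne_top) (EReal.coe_ennreal_ne_bot _)
  rw [CMDP.expect, lintegral_congr_ae neg_part]
  simp only [toENNReal_coe_sub]
  rw [← add_zero (_ - _), ← sub_self_min, ereal_coe_sub_add_coe_sub,
    ← lintegral_add_right _ (ha.min hb), ← lintegral_add_right _ (ha.min hb)]
  have sub_add_min (ω) : b ω - a ω + min (a ω) (b ω) = b ω := by rw [min_comm, tsub_add_min]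
  simp only [tsub_add_min, sub_add_min]

end ExtendedReal

section Semicontinuity

variable {X : Type*} [TopologicalSpace X] {s : Set X}

theorem upperSemicontinuousOn_of_uniform_approx {f : X → EReal}
    (h : ∀ ε : ℝ, 0 < ε → ∃ g : X → EReal, UpperSemicontinuousOn g s ∧
      ∀ x ∈ s, g x ≤ f x ∧ f x ≤ g x + ε) :
    UpperSemicontinuousOn f s := by
  intro x hx y hy
  obtain ⟨z, hxz, hzy⟩ := EReal.lt_iff_exists_real_btwn.1 hy
  obtain ⟨z', hzz', hz'y⟩ := EReal.lt_iff_exists_real_btwn.1 hzy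
  obtain ⟨g, hg, hgf⟩ := h (z' - z) (sub_pos.2 (EReal.coe_lt_coe_iff.1 hzz'))
  filter_upwards [hg x hx z ((hgf x hx).1.trans_lt hxz), self_mem_nhdsWithin] with x' hlt hx'
  calc f x' ≤ g x' + (z' - z : ℝ) := (hgf x' hx').2
    _ ≤ z + (z' - z : ℝ) := by gcongr
    _ = z' := by norm_cast; ring
    _ < y := hz'y

theorem lowerSemicontinuousOn_of_le_liminf_seq [FirstCountableTopology X] {Y : Type*}
    [CompleteLinearOrder Y] {f : X → Y}
    (h : ∀ x ∈ s, ∀ u : ℕ → X, (∀ k, u k ∈ s) → Tendsto u atTop (𝓝 x) →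
      f x ≤ liminf (fun k => f (u k)) atTop) :
    LowerSemicontinuousOn f s := by
  intro x hx y hy
  by_contra hfreq
  obtain ⟨u, hu, hus⟩ := exists_seq_forall_of_frequently
    ((not_eventually.1 hfreq).and_eventually self_mem_nhdsWithin)
  have le_y : liminf (fun k => f (u k)) atTop ≤ y :=
    liminf_le_of_frequently_le' (Frequently.of_forall fun k => not_lt.1 (hus k).1)
  exact hy.not_ge
    ((h x hx u (fun k => (hus k).2) (tendsto_nhds_of_tendsto_nhdsWithin hu)).trans le_y)

theorem lowerSemicontinuousOn_of_forall_eq {Y : Type*} [Preorder Y] {f : X → Y} {g : s → Y}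
    (hg : LowerSemicontinuous g) (hfg : ∀ x : s, f x = g x) : LowerSemicontinuousOn f s :=
  lowerSemicontinuous_restrict_iff.1 ((funext hfg : s.domRestrict f = g) ▸ hg)

theorem continuous_ereal_const_sub {c : EReal} (hc : c ≠ ⊤) (hc' : c ≠ ⊥) :
    Continuous fun x : EReal => c - x :=
  continuous_iff_continuousAt.2 fun x =>
    (EReal.continuousAt_add (p := (c, -x)) (.inl hc) (.inl hc')).comp
      (f := fun x : EReal => (c, -x)) (by fun_prop)

theorem lowerSemicontinuous_natCast_sub_toENNReal {r : X → EReal} (hr : UpperSemicontinuous r)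
    (l : ℕ) : LowerSemicontinuous fun x => (l - r x).toENNReal := by
  exact (continuous_ereal_const_sub (EReal.natCast_ne_top l)
    (EReal.natCast_ne_bot l)).ereal_toENNReal.comp_upperSemicontinuous_antitone hr fun x y hxy =>
    EReal.toENNReal_le_toENNReal (EReal.sub_le_sub le_rfl hxy)

end Semicontinuity

section LowerSemicontinuityOfIntegrals

theorem lintegral_eq_lintegral_meas_ofReal_lt {α : Type*} [MeasurableSpace α] (μ : Measure α)
    [SFinite μ] {g : α → ℝ≥0∞} (hg : Measurable g) :
    ∫⁻ x, g x ∂μ = ∫⁻ t in Set.Ioi (0 : ℝ), μ {x | ENNReal.ofReal t < g x} := by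
  have volume_section (c : ℝ≥0∞) :
      volume.restrict (Set.Ioi 0) {t : ℝ | ENNReal.ofReal t < c} = c := by
    rw [Measure.restrict_apply (measurableSet_lt ENNReal.measurable_ofReal measurable_const)]
    induction c with
    | top => simp
    | coe c =>
      have section_eq : {t : ℝ | ENNReal.ofReal t < c} ∩ Set.Ioi 0 = Set.Ioo 0 (c : ℝ) := by
        ext t
        simpa [and_comm] using fun ht : 0 < t => ENNReal.ofReal_lt_coe_iff ht.le
      simp [section_eq]
  have subgraph : MeasurableSet {y : α × ℝ | ENNReal.ofReal y.2 < g y.1} :=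
    measurableSet_lt (by fun_prop) (by fun_prop)
  calc ∫⁻ x, g x ∂μ
      = (μ.prod (volume.restrict (Set.Ioi 0))) {y : α × ℝ | ENNReal.ofReal y.2 < g y.1} := by
        rw [Measure.prod_apply subgraph]
        exact lintegral_congr fun x => (volume_section (g x)).symm
    _ = _ := Measure.prod_apply_symm subgraph

theorem lintegral_le_liminf_of_meas_lt_le_liminf {α : Type*} [MeasurableSpace α]
    {μ : Measure α} [SFinite μ] {μs : ℕ → Measure α} [∀ k, SFinite (μs k)]
    {g : α → ℝ≥0∞} (hg : Measurable g)
    (h : ∀ t, μ {x | t < g x} ≤ liminf (fun k => μs k {x | t < g x}) atTop) :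
    ∫⁻ x, g x ∂μ ≤ liminf (fun k => ∫⁻ x, g x ∂(μs k)) atTop := by
  simp_rw [lintegral_eq_lintegral_meas_ofReal_lt _ hg]
  refine (lintegral_mono fun t => h (ENNReal.ofReal t)).trans (lintegral_liminf_le fun k => ?_)
  have : Antitone fun t : ℝ => μs k {x | ENNReal.ofReal t < g x} := fun s t hst =>
    measure_mono fun x hx => (ENNReal.ofReal_le_ofReal hst).trans_lt hx
  exact this.measurable

theorem lintegral_le_liminf_of_lowerSemicontinuousOn {X : Type*} [TopologicalSpace X]
    [MeasurableSpace X] [OpensMeasurableSpace X] [HasOuterApproxClosed X]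
    {Q : ProbabilityMeasure X} {Qs : ℕ → ProbabilityMeasure X} (hQs : Tendsto Qs atTop (𝓝 Q))
    {G : Set X} (hQG : ∀ᵐ x ∂(Q : Measure X), x ∈ G)
    (hQsG : ∀ k, ∀ᵐ x ∂(Qs k : Measure X), x ∈ G)
    {g : X → ℝ≥0∞} (hg : Measurable g) (hlsc : LowerSemicontinuousOn g G) :
    ∫⁻ x, g x ∂Q ≤ liminf (fun k => ∫⁻ x, g x ∂(Qs k)) atTop := by
  refine lintegral_le_liminf_of_meas_lt_le_liminf hg fun t => ?_
  obtain ⟨U, hU, hGU⟩ := lowerSemicontinuousOn_iff_preimage_Ioi.1 hlsc t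
  have measure_eq {ν : Measure X} (hν : ∀ᵐ x ∂ν, x ∈ G) : ν {x | t < g x} = ν U :=
    calc ν {x | t < g x} = ν (G ∩ {x | t < g x}) := (Measure.measure_inter_eq_of_ae hν).symm
      _ = ν (G ∩ U) := congrArg ν hGU
      _ = ν U := Measure.measure_inter_eq_of_ae hν
  simp only [measure_eq hQG, measure_eq (hQsG _)]
  exact ProbabilityMeasure.le_liminf_measure_open_of_tendsto hQs hU

variable {S A : Type*} [MeasurableSpace S] [MeasurableSpace A]

theorem exists_measurableSet_forall_section_eq_empty_mem [StandardBorelSpace A] [Nonempty A]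
    (ν : Measure (S × A)) [IsFiniteMeasure ν] {C : Set (S × A)} (hC : MeasurableSet C) :
    ∃ E, MeasurableSet E ∧ (∀ s, Prod.mk s ⁻¹' C = ∅ → s ∈ E) ∧ ν (C ∩ Prod.fst ⁻¹' E) = 0 := by
  set E : Set S := {s | ν.condKernel s (Prod.mk s ⁻¹' C) = 0}
  have hE : MeasurableSet E :=
    Kernel.measurable_kernel_prodMk_left hC (measurableSet_singleton 0)
  refine ⟨E, hE, fun s hs => (congrArg _ hs).trans measure_empty, ?_⟩
  have hCE : MeasurableSet (C ∩ Prod.fst ⁻¹' E) := hC.inter (measurable_fst hE)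
  calc ν (C ∩ Prod.fst ⁻¹' E) = (ν.fst ⊗ₘ ν.condKernel) (C ∩ Prod.fst ⁻¹' E) := by
        rw [ν.disintegrate]
    _ = ∫⁻ s, ν.condKernel s (Prod.mk s ⁻¹' (C ∩ Prod.fst ⁻¹' E)) ∂(ν.fst) :=
        Measure.compProd_apply hCE
    _ = ∫⁻ _, 0 ∂(ν.fst) := lintegral_congr fun s => by
        by_cases hs : s ∈ E
        · exact measure_mono_null (Set.preimage_mono Set.inter_subset_left) hs
        · have section_eq : Prod.mk s ⁻¹' (C ∩ Prod.fst ⁻¹' E) = ∅ :=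
            Set.eq_empty_of_forall_notMem fun a ha => hs ha.2
          rw [section_eq, measure_empty]
    _ = 0 := lintegral_zero

variable [TopologicalSpace A] [SecondCountableTopology A]

theorem exists_iUnion_prod_of_isOpen_section [OpensMeasurableSpace A] [StandardBorelSpace A]
    [Nonempty A] (ν : Measure (S × A)) [IsFiniteMeasure ν] {G O : Set (S × A)}
    (hG : MeasurableSet G) (hO : MeasurableSet O)
    (hsec : ∀ s, ∃ U, IsOpen U ∧ Prod.mk s ⁻¹' (G ∩ O) = Prod.mk s ⁻¹' G ∩ U) :
    ∃ E : TopologicalSpace.countableBasis A → Set S, (∀ B, MeasurableSet (E B)) ∧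
      G ∩ O ⊆ ⋃ B, E B ×ˢ B.1 ∧ ν ((G ∩ ⋃ B, E B ×ˢ B.1) \ O) = 0 := by
  have isOpen_basis (B : TopologicalSpace.countableBasis A) : IsOpen B.1 :=
    TopologicalSpace.isOpen_of_mem_countableBasis B.2
  -- The set of `s` with `G_s ∩ B ⊆ O_s` need not be measurable; `E B` is a measurable superset
  -- of it on which the inclusion still holds up to a `ν`-null set.
  choose E hE hmem hnull using fun B : TopologicalSpace.countableBasis A =>
    exists_measurableSet_forall_section_eq_empty_mem ν
      ((hG.diff hO).inter (measurable_snd (isOpen_basis B).measurableSet))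
  refine ⟨E, hE, ?_, ?_⟩
  · rintro ⟨s, a⟩ hsa
    obtain ⟨U, hU, hGU⟩ := hsec s
    obtain ⟨B, hB, haB, hBU⟩ :=
      (TopologicalSpace.isBasis_countableBasis A).exists_subset_of_mem_open (hGU.subset hsa).2 hU
    refine Set.mem_iUnion.2 ⟨⟨B, hB⟩, hmem ⟨B, hB⟩ s ?_, haB⟩
    refine Set.eq_empty_of_forall_notMem fun b hb => hb.1.2 ?_
    exact (hGU.superset ⟨hb.1.1, hBU hb.2⟩).2
  · refine measure_mono_null (fun x hx => ?_) (measure_iUnion_null hnull)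
    obtain ⟨B, hE, hB⟩ := Set.mem_iUnion.1 hx.1.2
    exact Set.mem_iUnion.2 ⟨B, ⟨⟨hx.1.1, hx.2⟩, hB⟩, hE⟩

variable [TopologicalSpace S] [TopologicalSpace.PseudoMetrizableSpace S] [BorelSpace S]
  [TopologicalSpace.PseudoMetrizableSpace A] [BorelSpace A]
  {Q : ProbabilityMeasure (S × A)} {Qs : ℕ → ProbabilityMeasure (S × A)}

theorem measure_iUnion_prod_le_liminf (hQs : Tendsto Qs atTop (𝓝 Q))
    (hfst : ∀ D, MeasurableSet D →
      Tendsto (fun k => (Qs k : Measure (S × A)).fst D) atTop (𝓝 ((Q : Measure (S × A)).fst D)))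
    {ι : Type*} [Countable ι] {E : ι → Set S} {B : ι → Set A} (hE : ∀ j, MeasurableSet (E j))
    (hB : ∀ j, IsOpen (B j)) :
    (Q : Measure (S × A)) (⋃ j, E j ×ˢ B j) ≤
      liminf (fun k => (Qs k : Measure (S × A)) (⋃ j, E j ×ˢ B j)) atTop := by
  refine ENNReal.le_of_forall_pos_le_add fun ε hε _ => ?_
  obtain ⟨δ, hδ, hsum⟩ := ENNReal.exists_pos_sum_of_countable' (ENNReal.coe_pos.2 hε).ne' ι
  choose V hEV hV hVlt using fun j => (hE j).exists_isOpen_sdiff_lt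
    (measure_ne_top (Q : Measure (S × A)).fst (E j)) (hδ j).ne'
  set D : Set S := ⋃ j, V j \ E j
  have hD : MeasurableSet D := .iUnion fun j => (hV j).measurableSet.diff (hE j)
  have hDlt : (Q : Measure (S × A)).fst D < ε :=
    calc (Q : Measure (S × A)).fst D ≤ ∑' j, (Q : Measure (S × A)).fst (V j \ E j) :=
          measure_iUnion_le _
      _ ≤ ∑' j, δ j := ENNReal.tsum_le_tsum fun j => (hVlt j).2.le
      _ < ε := hsum
  have cover : ⋃ j, V j ×ˢ B j ⊆ (⋃ j, E j ×ˢ B j) ∪ Prod.fst ⁻¹' D := fun x hx => by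
    obtain ⟨j, hs, ha⟩ := Set.mem_iUnion.1 hx
    by_cases h : x.1 ∈ E j
    · exact .inl (Set.mem_iUnion.2 ⟨j, h, ha⟩)
    · exact .inr (Set.mem_iUnion.2 ⟨j, hs, h⟩)
  calc (Q : Measure (S × A)) (⋃ j, E j ×ˢ B j)
      ≤ (Q : Measure (S × A)) (⋃ j, V j ×ˢ B j) :=
        measure_mono (Set.iUnion_mono fun j => Set.prod_mono (hEV j) subset_rfl)
    _ ≤ liminf (fun k => (Qs k : Measure (S × A)) (⋃ j, V j ×ˢ B j)) atTop :=
        ProbabilityMeasure.le_liminf_measure_open_of_tendsto hQs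
          (isOpen_iUnion fun j => (hV j).prod (hB j))
    _ ≤ liminf (fun k => (Qs k : Measure (S × A)) (⋃ j, E j ×ˢ B j) + ε) atTop := by
        refine liminf_le_liminf ?_
        filter_upwards [(hfst D hD).eventually_lt_const hDlt] with k hk
        exact (measure_mono cover).trans ((measure_union_le _ _).trans
          (add_le_add le_rfl ((Measure.fst_apply hD).ge.trans hk.le)))
    _ = liminf (fun k => (Qs k : Measure (S × A)) (⋃ j, E j ×ˢ B j)) atTop + ε :=
        liminf_add_const atTop _ _ (by isBoundedDefault) (by isBoundedDefault)

variable [StandardBorelSpace A]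

theorem measure_le_liminf_of_isOpen_section (hQs : Tendsto Qs atTop (𝓝 Q))
    (hfst : ∀ D, MeasurableSet D →
      Tendsto (fun k => (Qs k : Measure (S × A)).fst D) atTop (𝓝 ((Q : Measure (S × A)).fst D)))
    {G O : Set (S × A)} (hG : MeasurableSet G) (hO : MeasurableSet O)
    (hQG : ∀ᵐ x ∂(Q : Measure (S × A)), x ∈ G)
    (hQsG : ∀ k, ∀ᵐ x ∂(Qs k : Measure (S × A)), x ∈ G)
    (hsec : ∀ s, ∃ U, IsOpen U ∧ Prod.mk s ⁻¹' (G ∩ O) = Prod.mk s ⁻¹' G ∩ U) :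
    (Q : Measure (S × A)) O ≤ liminf (fun k => (Qs k : Measure (S × A)) O) atTop := by
  have : Nonempty A := (nonempty_of_isProbabilityMeasure (Q : Measure (S × A))).map Prod.snd
  -- A single `ν` dominating every `Qs k` makes one family of rectangles serve all `k`.
  obtain ⟨ν, _, hν, -⟩ := exists_isFiniteMeasure_absolutelyContinuous
    (Measure.sum fun k => (Qs k : Measure (S × A)))
  obtain ⟨E, hE, hsub, hnull⟩ := exists_iUnion_prod_of_isOpen_section ν hG hO hsec
  have isOpen_basis (B : TopologicalSpace.countableBasis A) : IsOpen B.1 :=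
    TopologicalSpace.isOpen_of_mem_countableBasis B.2
  have measure_rect_le (k : ℕ) : (Qs k : Measure (S × A)) (⋃ B, E B ×ˢ B.1) ≤
      (Qs k : Measure (S × A)) O := by
    rw [← Measure.measure_inter_eq_of_ae (hQsG k)]
    refine measure_mono_ae (ae_le_set.2 ?_)
    exact (Measure.absolutelyContinuous_of_le (Measure.le_sum _ k)).trans hν hnull
  calc (Q : Measure (S × A)) O = (Q : Measure (S × A)) (G ∩ O) :=
        (Measure.measure_inter_eq_of_ae hQG).symm
    _ ≤ (Q : Measure (S × A)) (⋃ B, E B ×ˢ B.1) := measure_mono hsub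
    _ ≤ liminf (fun k => (Qs k : Measure (S × A)) (⋃ B, E B ×ˢ B.1)) atTop :=
        measure_iUnion_prod_le_liminf hQs hfst hE isOpen_basis
    _ ≤ liminf (fun k => (Qs k : Measure (S × A)) O) atTop :=
        liminf_le_liminf (Eventually.of_forall measure_rect_le)

theorem lintegral_le_liminf_of_lowerSemicontinuousOn_section (hQs : Tendsto Qs atTop (𝓝 Q))
    (hfst : ∀ D, MeasurableSet D →
      Tendsto (fun k => (Qs k : Measure (S × A)).fst D) atTop (𝓝 ((Q : Measure (S × A)).fst D)))
    {G : Set (S × A)} (hG : MeasurableSet G) (hQG : ∀ᵐ x ∂(Q : Measure (S × A)), x ∈ G)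
    (hQsG : ∀ k, ∀ᵐ x ∂(Qs k : Measure (S × A)), x ∈ G)
    {g : S × A → ℝ≥0∞} (hg : Measurable g)
    (hlsc : ∀ s, LowerSemicontinuousOn (fun a => g (s, a)) (Prod.mk s ⁻¹' G)) :
    ∫⁻ x, g x ∂Q ≤ liminf (fun k => ∫⁻ x, g x ∂(Qs k)) atTop :=
  lintegral_le_liminf_of_meas_lt_le_liminf hg fun t =>
    measure_le_liminf_of_isOpen_section hQs hfst hG (measurableSet_lt measurable_const hg)
      hQG hQsG fun s => lowerSemicontinuousOn_iff_preimage_Ioi.1 (hlsc s) t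

end LowerSemicontinuityOfIntegrals

section DiscountedTotal

variable {X : Type*} [MeasurableSpace X]

/-- The law of the `n`-th term of a random sequence with law `P`. -/
noncomputable def coordLaw (n : ℕ) (P : ProbabilityMeasure (ℕ → X)) : ProbabilityMeasure X :=
  P.map (measurable_pi_apply n).aemeasurable

/-- The expected discounted sum, with discount factor `β`, of a nonnegative function along a random
sequence with law `P`. The exponents start at `0`. -/
noncomputable def discountedTotal (β : ℝ) (f : X → ℝ≥0∞) (P : ProbabilityMeasure (ℕ → X)) :
    ℝ≥0∞ :=
  ∫⁻ ω, ∑' n : ℕ, ENNReal.ofReal (β ^ n) * f (ω n) ∂(P : Measure (ℕ → X))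

variable {β : ℝ} {f g : X → ℝ≥0∞} {P : ProbabilityMeasure (ℕ → X)}

theorem toMeasure_coordLaw (n : ℕ) (P : ProbabilityMeasure (ℕ → X)) :
    (coordLaw n P : Measure X) = (P : Measure (ℕ → X)).map fun ω => ω n :=
  rfl

theorem lintegral_coordLaw (n : ℕ) (P : ProbabilityMeasure (ℕ → X)) (hf : Measurable f) :
    ∫⁻ x, f x ∂(coordLaw n P) = ∫⁻ ω, f (ω n) ∂(P : Measure (ℕ → X)) :=
  lintegral_map hf (measurable_pi_apply n)

theorem tendsto_coordLaw [TopologicalSpace X] [BorelSpace X]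
    [OpensMeasurableSpace (ℕ → X)] (n : ℕ) {ι : Type*} {L : Filter ι}
    {Ps : ι → ProbabilityMeasure (ℕ → X)} (hPs : Tendsto Ps L (𝓝 P)) :
    Tendsto (fun k => coordLaw n (Ps k)) L (𝓝 (coordLaw n P)) :=
  ProbabilityMeasure.tendsto_map_of_tendsto_of_continuous Ps P hPs (continuous_apply n)

theorem measurable_tsum_discounted (β : ℝ) (hf : Measurable f) :
    Measurable fun ω : ℕ → X => ∑' n : ℕ, ENNReal.ofReal (β ^ n) * f (ω n) := by
  fun_prop

theorem discountedTotal_eq_tsum (β : ℝ) (hf : Measurable f) (P : ProbabilityMeasure (ℕ → X)) :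
    discountedTotal β f P = ∑' n : ℕ, ENNReal.ofReal (β ^ n) * ∫⁻ x, f x ∂(coordLaw n P) := by
  have measurable_eval (n : ℕ) : Measurable fun ω : ℕ → X => f (ω n) :=
    hf.comp (measurable_pi_apply n)
  rw [discountedTotal, lintegral_tsum fun n => ((measurable_eval n).const_mul _).aemeasurable]
  simp_rw [lintegral_coordLaw _ P hf]
  exact tsum_congr fun n => lintegral_const_mul _ (measurable_eval n)

theorem discountedTotal_add (β : ℝ) (hf : Measurable f) (g : X → ℝ≥0∞)
    (P : ProbabilityMeasure (ℕ → X)) :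
    discountedTotal β (fun x => f x + g x) P =
      discountedTotal β f P + discountedTotal β g P := by
  simp only [discountedTotal, mul_add, ENNReal.tsum_add]
  exact lintegral_add_left (measurable_tsum_discounted β hf) _

theorem discountedTotal_mono (β : ℝ) (P : ProbabilityMeasure (ℕ → X)) (hfg : ∀ x, f x ≤ g x) :
    discountedTotal β f P ≤ discountedTotal β g P :=
  lintegral_mono fun ω => ENNReal.tsum_le_tsum fun n => mul_le_mul_right (hfg (ω n)) _

theorem discountedTotal_const (β : ℝ) (c : ℝ≥0∞) (P : ProbabilityMeasure (ℕ → X)) :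
    discountedTotal β (fun _ => c) P = (∑' n : ℕ, ENNReal.ofReal (β ^ n)) * c := by
  simp [discountedTotal, ENNReal.tsum_mul_right]

theorem discountedTotal_const_ne_top (hβ : 0 ≤ β) (hβ' : β < 1) {c : ℝ≥0∞} (hc : c ≠ ⊤)
    (P : ProbabilityMeasure (ℕ → X)) :
    discountedTotal β (fun _ => c) P ≠ ⊤ := by
  rw [discountedTotal_const]
  exact ENNReal.mul_ne_top (summable_geometric_of_lt_one hβ hβ').tsum_ofReal_ne_top hc

theorem lowerSemicontinuousOn_discountedTotal [TopologicalSpace X] [OpensMeasurableSpace (ℕ → X)]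
    {T : Set (ProbabilityMeasure (ℕ → X))} (β : ℝ) (hf : Measurable f)
    (hlsc : ∀ n, LowerSemicontinuousOn (fun P => ∫⁻ x, f x ∂(coordLaw n P)) T) :
    LowerSemicontinuousOn (discountedTotal β f) T := by
  simp_rw [funext (discountedTotal_eq_tsum β hf)]
  exact lowerSemicontinuousOn_tsum fun n =>
    (ENNReal.continuous_const_mul ENNReal.ofReal_ne_top).comp_lowerSemicontinuousOn (hlsc n)
      fun x y hxy => mul_le_mul_right hxy _

theorem expect_tsum_coe_sub (hβ : 0 ≤ β) (hf : Measurable f) (hg : Measurable g)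
    (hfin : discountedTotal β f P ≠ ⊤) :
    CMDP.expect (P : Measure (ℕ → X))
        (fun ω => ∑' n : ℕ, ((β ^ n : ℝ) : EReal) * ((f (ω n) : EReal) - g (ω n))) =
      (discountedTotal β f P : EReal) - discountedTotal β g P := by
  have ae_eq : (fun ω => ∑' n : ℕ, ((β ^ n : ℝ) : EReal) * ((f (ω n) : EReal) - g (ω n)))
      =ᵐ[(P : Measure (ℕ → X))] fun ω =>
        ((∑' n : ℕ, ENNReal.ofReal (β ^ n) * f (ω n) : ℝ≥0∞) : EReal) -
          ((∑' n : ℕ, ENNReal.ofReal (β ^ n) * g (ω n) : ℝ≥0∞) : EReal) := by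
    filter_upwards [ae_lt_top (measurable_tsum_discounted β hf) hfin] with ω hω
    simp only [ereal_coe_mul_coe_sub (pow_nonneg hβ _), ereal_tsum_coe_sub hω.ne]
  exact (expect_congr_ae ae_eq).trans (expect_coe_sub (measurable_tsum_discounted β hf)
    (measurable_tsum_discounted β hg) hfin)

end DiscountedTotal

namespace CMDP

section Measurable

variable {S : Type u} {A : Type v} [MeasurableSpace S] [MeasurableSpace A] {m : ℕ}

theorem reward_coe (M : CMDP S A m) (i : Fin (m + 1)) (k : M.K) : M.reward i k.1 = M.r i k :=
  dif_pos k.2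

theorem measurable_reward (M : CMDP S A m) (i : Fin (m + 1)) : Measurable (M.reward i) := by
  classical
  exact Measurable.dite (M.measurable_r i) measurable_const M.measurableSet_graph

/-- The part of the reward above the truncation level `l`. -/
noncomputable def excess (M : CMDP S A m) (i : Fin (m + 1)) (l : ℕ) (x : S × A) : ℝ≥0∞ :=
  (M.reward i x - l).toENNReal

/-- The amount by which the reward falls short of the truncation level `l`. -/
noncomputable def shortfall (M : CMDP S A m) (i : Fin (m + 1)) (l : ℕ) (x : S × A) : ℝ≥0∞ :=
  (l - M.reward i x).toENNReal

theorem measurable_excess (M : CMDP S A m) (i : Fin (m + 1)) (l : ℕ) :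
    Measurable (M.excess i l) :=
  ((M.measurable_reward i).sub measurable_const).ereal_toENNReal

theorem measurable_shortfall (M : CMDP S A m) (i : Fin (m + 1)) (l : ℕ) :
    Measurable (M.shortfall i l) :=
  (measurable_const.sub (M.measurable_reward i)).ereal_toENNReal

theorem reward_eq_add_excess_sub_shortfall (M : CMDP S A m) (i : Fin (m + 1)) (l : ℕ) (x : S × A) :
    M.reward i x = ((l + M.excess i l x : ℝ≥0∞) : EReal) - M.shortfall i l x :=
  ereal_eq_natCast_add_toENNReal_sub _ l

theorem toENNReal_reward_le (M : CMDP S A m) (i : Fin (m + 1)) (l : ℕ) (x : S × A) :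
    (M.reward i x).toENNReal ≤ l + M.excess i l x := by
  rw [← EReal.toENNReal_coe (x := l + M.excess i l x)]
  exact EReal.toENNReal_le_toENNReal
    ((M.reward_eq_add_excess_sub_shortfall i l x).trans_le (ereal_sub_coe_le_self _ _))

theorem excess_le_indicator {M : CMDP S A m} {w : S → ℝ} {i : Fin (m + 1)}
    (hrw : ∀ k : M.K, M.r i k ≤ (w k.1.1 : EReal)) (l : ℕ) (x : S × A) :
    M.excess i l x ≤ {s | (l : ℝ) ≤ w s}.indicator (fun s => ENNReal.ofReal (w s)) x.1 := by
  by_cases hx : x.2 ∈ M.act x.1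
  · have le_w : M.reward i x ≤ (w x.1 : EReal) := (M.reward_coe i ⟨x, hx⟩).trans_le (hrw ⟨x, hx⟩)
    by_cases hl : (l : ℝ) ≤ w x.1
    · rw [Set.indicator_of_mem (show x.1 ∈ {s | (l : ℝ) ≤ w s} from hl), excess]
      refine (EReal.toENNReal_le_toENNReal ((EReal.sub_le_of_le_add ?_).trans le_w)).trans_eq ?_
      · exact le_add_of_nonneg_right (Nat.cast_nonneg' l)
      · exact EReal.real_coe_toENNReal _
    · rw [excess, EReal.toENNReal_of_nonpos]
      · exact zero_le
      · exact EReal.sub_nonpos.2 (le_w.trans (EReal.coe_le_coe_iff.2 (not_le.1 hl).le))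
  · rw [excess, reward, dif_neg hx, EReal.toENNReal_of_nonpos]
    · exact zero_le
    · exact EReal.sub_nonpos.2 (Nat.cast_nonneg' l)

theorem discountedTotal_excess_le {M : CMDP S A m} {w : S → ℝ} {i : Fin (m + 1)}
    (hrw : ∀ k : M.K, M.r i k ≤ (w k.1.1 : EReal)) (l N : ℕ)
    (P : ProbabilityMeasure (ℕ → S × A)) :
    discountedTotal M.β (M.excess i l) P ≤
      ∑ n ∈ Finset.range N, ∫⁻ ω, {s | (l : ℝ) ≤ w s}.indicator
          (fun s => ENNReal.ofReal (w s)) (ω n).1 ∂(P : Measure (ℕ → S × A)) +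
        ∫⁻ ω, ∑' k, ENNReal.ofReal (M.β ^ (N + k) * w (ω (N + k)).1)
          ∂(P : Measure (ℕ → S × A)) := by
  have measurable_eval (n : ℕ) : Measurable fun ω : ℕ → S × A => M.excess i l (ω n) :=
    (M.measurable_excess i l).comp (measurable_pi_apply n)
  have excess_le_ofReal (x : S × A) : M.excess i l x ≤ ENNReal.ofReal (w x.1) :=
    (excess_le_indicator hrw l x).trans (Set.indicator_le_self _ _ _)
  calc discountedTotal M.β (M.excess i l) P
      = ∫⁻ ω, (∑ n ∈ Finset.range N, ENNReal.ofReal (M.β ^ n) * M.excess i l (ω n) +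
          ∑' k, ENNReal.ofReal (M.β ^ (N + k)) * M.excess i l (ω (N + k)))
          ∂(P : Measure (ℕ → S × A)) := by
        simp only [discountedTotal, add_comm N, ENNReal.summable.sum_add_tsum_nat_add']
    _ = ∑ n ∈ Finset.range N, ∫⁻ ω, ENNReal.ofReal (M.β ^ n) * M.excess i l (ω n)
            ∂(P : Measure (ℕ → S × A)) +
          ∫⁻ ω, ∑' k, ENNReal.ofReal (M.β ^ (N + k)) * M.excess i l (ω (N + k))
            ∂(P : Measure (ℕ → S × A)) := by
        rw [lintegral_add_left (Finset.measurable_fun_sum _ fun n _ =>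
          (measurable_eval n).const_mul _), lintegral_finsetSum _ fun n _ =>
          (measurable_eval n).const_mul _]
    _ ≤ _ := by
        refine add_le_add (Finset.sum_le_sum fun n _ => lintegral_mono fun ω => ?_)
          (lintegral_mono fun ω => ENNReal.tsum_le_tsum fun k => ?_)
        · have pow_le_one : ENNReal.ofReal (M.β ^ n) ≤ 1 :=
            ENNReal.ofReal_le_one.2 (pow_le_one₀ M.β_pos.le M.β_lt_one.le)
          exact (mul_le_of_le_one_left' pow_le_one).trans (excess_le_indicator hrw l _)
        · rw [ENNReal.ofReal_mul (pow_nonneg M.β_pos.le _)]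
          exact mul_le_mul_right (excess_le_ofReal _) _

theorem UniformlyIntegrable.exists_forall_discountedTotal_excess_le {M : CMDP S A m} {w : S → ℝ}
    (hw : M.UniformlyIntegrable w) {i : Fin (m + 1)}
    (hrw : ∀ k : M.K, M.r i k ≤ (w k.1.1 : EReal)) {ε : ℝ≥0∞} (hε : ε ≠ 0) :
    ∃ l : ℕ, ∀ P ∈ M.strategicMeasures, discountedTotal M.β (M.excess i l) P ≤ ε := by
  have half_pos : 0 < ε / 2 := ENNReal.half_pos hε
  obtain ⟨N, hN⟩ := (hw.tail.eventually_lt_const half_pos).exists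
  have tendsto_head := tendsto_finsetSum (Finset.range N) fun n _ => hw.unifInt n
  rw [Finset.sum_const_zero] at tendsto_head
  obtain ⟨l, hl⟩ := (tendsto_head.eventually_lt_const half_pos).exists
  refine ⟨l, fun P hP => (discountedTotal_excess_le hrw l N P).trans ?_⟩
  rw [← ENNReal.add_halves ε]
  refine add_le_add (le_trans ?_ hl.le) (le_trans ?_ hN.le)
  · exact Finset.sum_le_sum fun n _ => le_iSup₂_of_le P hP le_rfl
  · exact le_iSup₂_of_le P hP le_rfl

section Decomposition

variable {M : CMDP S A m} {i : Fin (m + 1)} {l : ℕ} {P : ProbabilityMeasure (ℕ → S × A)}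

theorem discountedTotal_natCast_add_excess_ne_top
    (h : discountedTotal M.β (M.excess i l) P ≠ ⊤) :
    discountedTotal M.β (fun x => l + M.excess i l x) P ≠ ⊤ := by
  rw [discountedTotal_add _ measurable_const]
  exact ENNReal.add_ne_top.2 ⟨discountedTotal_const_ne_top M.β_pos.le M.β_lt_one
    (ENNReal.natCast_ne_top l) P, h⟩

theorem Jpos_lt_top (h : discountedTotal M.β (M.excess i l) P ≠ ⊤) : M.Jpos i P < ⊤ :=
  (discountedTotal_mono M.β P (M.toENNReal_reward_le i l)).trans_lt
    (discountedTotal_natCast_add_excess_ne_top h).lt_top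

theorem J_eq_sub (h : discountedTotal M.β (M.excess i l) P ≠ ⊤) :
    M.J i P = (discountedTotal M.β (fun x => l + M.excess i l x) P : EReal) -
      discountedTotal M.β (M.shortfall i l) P := by
  simp only [J, M.reward_eq_add_excess_sub_shortfall i l]
  exact expect_tsum_coe_sub (f := fun x => l + M.excess i l x) M.β_pos.le
    (measurable_const.add (M.measurable_excess i l)) (M.measurable_shortfall i l)
    (discountedTotal_natCast_add_excess_ne_top h)

theorem J_lt_top (h : discountedTotal M.β (M.excess i l) P ≠ ⊤) : M.J i P < ⊤ := by
  rw [J_eq_sub h]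
  refine (ereal_sub_coe_le_self _ _).trans_lt (lt_top_iff_ne_top.2 ?_)
  simpa using discountedTotal_natCast_add_excess_ne_top h

theorem exists_upperSemicontinuousOn_approx_J [TopologicalSpace S] [TopologicalSpace A]
    [OpensMeasurableSpace (ℕ → S × A)] {T : Set (ProbabilityMeasure (ℕ → S × A))} {ε : ℝ≥0∞}
    (hlsc : LowerSemicontinuousOn (discountedTotal M.β (M.shortfall i l)) T) (hε' : ε ≠ ⊤)
    (hε : ∀ P ∈ T, discountedTotal M.β (M.excess i l) P ≤ ε) :
    ∃ G : ProbabilityMeasure (ℕ → S × A) → EReal, UpperSemicontinuousOn G T ∧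
      ∀ P ∈ T, G P ≤ M.J i P ∧ M.J i P ≤ G P + ε := by
  set c : ℝ≥0∞ := (∑' n : ℕ, ENNReal.ofReal (M.β ^ n)) * l with c_def
  have c_ne_top : c ≠ ⊤ := ENNReal.mul_ne_top
    (summable_geometric_of_lt_one M.β_pos.le M.β_lt_one).tsum_ofReal_ne_top
    (ENNReal.natCast_ne_top l)
  have J_eq {P} (hP : P ∈ T) : M.J i P =
      (c - discountedTotal M.β (M.shortfall i l) P : EReal) +
        discountedTotal M.β (M.excess i l) P := by
    rw [J_eq_sub ((hε P hP).trans_lt hε'.lt_top).ne,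
      discountedTotal_add _ measurable_const, discountedTotal_const, ← c_def, EReal.coe_ennreal_add]
    simp only [sub_eq_add_neg, add_right_comm]
  refine ⟨fun P => c - discountedTotal M.β (M.shortfall i l) P, ?_, fun P hP => ?_⟩
  · exact ((continuous_ereal_const_sub (by simpa using c_ne_top)
      (EReal.coe_ennreal_ne_bot c)).comp continuous_coe_ennreal_ereal
      ).comp_lowerSemicontinuousOn_antitone hlsc fun x y hxy =>
        EReal.sub_le_sub le_rfl (EReal.coe_ennreal_le_coe_ennreal_iff.2 hxy)
  · rw [J_eq hP]
    refine ⟨le_add_of_nonneg_right (EReal.coe_ennreal_nonneg _), ?_⟩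
    gcongr
    exact EReal.coe_ennreal_le_coe_ennreal_iff.2 (hε P hP)

end Decomposition

theorem IsTrajectoryLaw.measure_state_succ_mem {M : CMDP S A m} {π : M.Policy}
    {Q : Measure (ℕ → M.K)} [IsFiniteMeasure Q] (h : M.IsTrajectoryLaw π Q) (n : ℕ) {D : Set S}
    (hD : MeasurableSet D) : Q {ω | (ω (n + 1)).1.1 ∈ D} = ∫⁻ ω, M.p (ω n) D ∂Q := by
  have := M.isMarkovKernel_p
  have measurable_past : Measurable (M.past (n + 1)) :=
    measurable_pi_lambda _ fun i => measurable_pi_apply _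
  have measurable_state : Measurable fun ω : ℕ → M.K => (ω (n + 1)).1.1 := by fun_prop
  have transition := congrArg (fun ρ => ρ (Prod.snd ⁻¹' D)) (h.transition n)
  rw [Measure.map_apply (measurable_past.prodMk measurable_state) (measurable_snd hD),
    Measure.compProd_apply (measurable_snd hD),
    lintegral_map (Kernel.measurable_kernel_prodMk_left (measurable_snd hD)) measurable_past]
    at transition
  exact transition

section StrategicMeasures

variable {M : CMDP S A m} {P : ProbabilityMeasure (ℕ → S × A)}

theorem toMeasure_coordLaw_of_eq_map {Q : Measure (ℕ → M.K)}
    (hPQ : (P : Measure (ℕ → S × A)) = Q.map fun ω n => (ω n).1) (n : ℕ) :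
    (coordLaw n P : Measure (S × A)) = Q.map fun ω => (ω n).1 := by
  rw [toMeasure_coordLaw, hPQ, Measure.map_map (by fun_prop) (by fun_prop)]
  rfl

theorem ae_mem_act_coordLaw (hP : P ∈ M.strategicMeasures) (n : ℕ) :
    ∀ᵐ x ∂(coordLaw n P : Measure (S × A)), x ∈ {x : S × A | x.2 ∈ M.act x.1} := by
  obtain ⟨π, Q, -, hPQ⟩ := hP
  rw [toMeasure_coordLaw_of_eq_map hPQ]
  have measurable_eval : Measurable fun ω : ℕ → M.K => (ω n).1 := by fun_prop
  exact (ae_map_iff measurable_eval.aemeasurable M.measurableSet_graph).2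
    (Eventually.of_forall fun ω => (ω n).2)

theorem fst_coordLaw_zero (hP : P ∈ M.strategicMeasures) :
    (coordLaw 0 P : Measure (S × A)).fst = M.μ := by
  obtain ⟨π, Q, hQ, hPQ⟩ := hP
  rw [Measure.fst, toMeasure_coordLaw_of_eq_map hPQ, Measure.map_map (by fun_prop) (by fun_prop),
    ← hQ.initial]
  rfl

theorem measurable_extend_p (M : CMDP S A m) {D : Set S} (hD : MeasurableSet D) :
    Measurable (Function.extend Subtype.val (fun k : M.K => M.p k D) 0) :=
  (MeasurableEmbedding.subtype_coe M.measurableSet_graph).measurable_extend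
    (M.p.measurable_coe hD) measurable_const

theorem fst_coordLaw_succ_apply (hP : P ∈ M.strategicMeasures) (n : ℕ) {D : Set S}
    (hD : MeasurableSet D) :
    (coordLaw (n + 1) P : Measure (S × A)).fst D =
      ∫⁻ x, Function.extend Subtype.val (fun k : M.K => M.p k D) 0 x ∂(coordLaw n P) := by
  obtain ⟨π, Q, hQ, hPQ⟩ := hP
  have : IsProbabilityMeasure (Q.map fun (ω : ℕ → M.K) n => (ω n).1) := hPQ ▸ inferInstance
  have : IsProbabilityMeasure Q :=
    Measure.isProbabilityMeasure_of_map fun (ω : ℕ → M.K) n => (ω n).1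
  rw [Measure.fst_apply hD, toMeasure_coordLaw_of_eq_map hPQ, toMeasure_coordLaw_of_eq_map hPQ,
    Measure.map_apply (by fun_prop) (measurable_fst hD),
    lintegral_map (M.measurable_extend_p hD) (by fun_prop)]
  simp_rw [Subtype.val_injective.extend_apply]
  exact hQ.measure_state_succ_mem n hD

end StrategicMeasures

end Measurable

section Topological

open TopologicalSpace

variable {S : Type u} {A : Type v} [TopologicalSpace S] [PseudoMetrizableSpace S]
  [SecondCountableTopology S] [MeasurableSpace S] [BorelSpace S]
  [TopologicalSpace A] [PseudoMetrizableSpace A] [SecondCountableTopology A] [MeasurableSpace A]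
  [BorelSpace A] {m : ℕ} {M : CMDP S A m}

theorem lowerSemicontinuousOn_lintegral_coordLaw (n : ℕ) {g : S × A → ℝ≥0∞} (hg : Measurable g)
    (hlsc : LowerSemicontinuousOn g {x | x.2 ∈ M.act x.1}) :
    LowerSemicontinuousOn (fun P => ∫⁻ x, g x ∂(coordLaw n P)) M.strategicMeasures :=
  lowerSemicontinuousOn_of_le_liminf_seq fun _ hP _ hPs hlim =>
    lintegral_le_liminf_of_lowerSemicontinuousOn (tendsto_coordLaw n hlim)
      (ae_mem_act_coordLaw hP n) (fun k => ae_mem_act_coordLaw (hPs k) n) hg hlsc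

variable [StandardBorelSpace A]

theorem tendsto_fst_coordLaw
    (hp : ∀ s D, MeasurableSet D → Continuous fun a : M.act s => M.p ⟨(s, a.1), a.2⟩ D)
    {P : ProbabilityMeasure (ℕ → S × A)} (hP : P ∈ M.strategicMeasures)
    {Ps : ℕ → ProbabilityMeasure (ℕ → S × A)} (hPs : ∀ k, Ps k ∈ M.strategicMeasures)
    (hlim : Tendsto Ps atTop (𝓝 P)) (n : ℕ) {D : Set S} (hD : MeasurableSet D) :
    Tendsto (fun k => (coordLaw n (Ps k) : Measure (S × A)).fst D) atTop
      (𝓝 ((coordLaw n P : Measure (S × A)).fst D)) := by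
  induction n generalizing D with
  | zero => simp only [fst_coordLaw_zero hP, fst_coordLaw_zero (hPs _), tendsto_const_nhds]
  | succ n ih =>
    have le_liminf {E : Set S} (hE : MeasurableSet E) :
        (coordLaw (n + 1) P : Measure (S × A)).fst E ≤
          liminf (fun k => (coordLaw (n + 1) (Ps k) : Measure (S × A)).fst E) atTop := by
      simp only [fst_coordLaw_succ_apply hP n hE, fst_coordLaw_succ_apply (hPs _) n hE]
      refine lintegral_le_liminf_of_lowerSemicontinuousOn_section (tendsto_coordLaw n hlim)
        (fun F hF => ih hF) M.measurableSet_graph (ae_mem_act_coordLaw hP n)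
        (fun k => ae_mem_act_coordLaw (hPs k) n) (M.measurable_extend_p hE) fun s => ?_
      exact lowerSemicontinuousOn_of_forall_eq (hp s E hE).lowerSemicontinuous fun a =>
        Subtype.val_injective.extend_apply _ _ (⟨(s, a.1), a.2⟩ : M.K)
    exact tendsto_measure_of_le_liminf_measure_of_limsup_measure_le subset_rfl subset_rfl
      (by simp) (le_liminf hD)
      (limsup_measure_le_of_le_liminf_measure_compl hD (le_liminf hD.compl))

theorem lowerSemicontinuousOn_lintegral_coordLaw_of_section
    (hp : ∀ s D, MeasurableSet D → Continuous fun a : M.act s => M.p ⟨(s, a.1), a.2⟩ D)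
    (n : ℕ) {g : S × A → ℝ≥0∞} (hg : Measurable g)
    (hlsc : ∀ s, LowerSemicontinuousOn (fun a => g (s, a)) (M.act s)) :
    LowerSemicontinuousOn (fun P => ∫⁻ x, g x ∂(coordLaw n P)) M.strategicMeasures :=
  lowerSemicontinuousOn_of_le_liminf_seq fun _ hP _ hPs hlim =>
    lintegral_le_liminf_of_lowerSemicontinuousOn_section (tendsto_coordLaw n hlim)
      (fun _ hD => tendsto_fst_coordLaw hp hP hPs hlim n hD) M.measurableSet_graph
      (ae_mem_act_coordLaw hP n) (fun k => ae_mem_act_coordLaw (hPs k) n) hg hlsc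

theorem lowerSemicontinuousOn_discountedTotal_shortfall {i : Fin (m + 1)}
    (h : UpperSemicontinuous (M.r i) ∨
      (∀ s D, MeasurableSet D → Continuous fun a : M.act s => M.p ⟨(s, a.1), a.2⟩ D) ∧
        ∀ s, UpperSemicontinuous fun a : M.act s => M.r i ⟨(s, a.1), a.2⟩) (l : ℕ) :
    LowerSemicontinuousOn (discountedTotal M.β (M.shortfall i l)) M.strategicMeasures := by
  have shortfall_coe (k : M.K) : M.shortfall i l k.1 = (l - M.r i k).toENNReal := by
    rw [shortfall, reward_coe]
  refine lowerSemicontinuousOn_discountedTotal M.β (M.measurable_shortfall i l) fun n => ?_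
  rcases h with usc_r | ⟨hp, usc_r⟩
  · refine lowerSemicontinuousOn_lintegral_coordLaw n (M.measurable_shortfall i l) ?_
    exact lowerSemicontinuousOn_of_forall_eq
      (lowerSemicontinuous_natCast_sub_toENNReal usc_r l) shortfall_coe
  · refine lowerSemicontinuousOn_lintegral_coordLaw_of_section hp n
      (M.measurable_shortfall i l) fun s => ?_
    exact lowerSemicontinuousOn_of_forall_eq
      (lowerSemicontinuous_natCast_sub_toENNReal (usc_r s) l) fun a =>
        shortfall_coe ⟨(s, a.1), a.2⟩

end Topological

end CMDP

theorem standardBorelSpace_of_measurableEmbedding {Y Z : Type*} [MeasurableSpace Y]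
    [MeasurableSpace Z] [StandardBorelSpace Z] {f : Y → Z} (hf : MeasurableEmbedding f) :
    StandardBorelSpace Y := by
  obtain ⟨t, _, _, isClosed_range, -⟩ := hf.measurableSet_range.isClopenable'
  let : TopologicalSpace Y := t.induced f
  have isClosedEmbedding : IsClosedEmbedding f := ⟨⟨⟨rfl⟩, hf.injective⟩, isClosed_range⟩
  refine ⟨t.induced f, ⟨?_⟩, isClosedEmbedding.polishSpace⟩
  rw [borel_comap, ← BorelSpace.measurable_eq, hf.comap_eq]

namespace BorelSubspaceOfPolish

variable (Y : Type u) [TopologicalSpace Y] [MeasurableSpace Y] [h : BorelSubspaceOfPolish Y]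

instance metrizableSpace : TopologicalSpace.MetrizableSpace Y := by
  obtain ⟨Z, _, _, f, hf, -⟩ := h.exists_embedding
  exact hf.metrizableSpace

instance standardBorelSpace : StandardBorelSpace Y := by
  obtain ⟨Z, _, _, f, hf, measurableSet_range⟩ := h.exists_embedding
  borelize Z
  exact standardBorelSpace_of_measurableEmbedding (hf.measurableEmbedding measurableSet_range)

end BorelSubspaceOfPolish

theorem lemma2_general {S : Type u} {A : Type v}
    [TopologicalSpace S] [TopologicalSpace.PseudoMetrizableSpace S] [SecondCountableTopology S]
    [MeasurableSpace S] [BorelSpace S]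
    [TopologicalSpace A] [TopologicalSpace.PseudoMetrizableSpace A] [SecondCountableTopology A]
    [MeasurableSpace A] [BorelSpace A] [StandardBorelSpace A]
    {m : ℕ} (M : CMDP S A m) (w : S → ℝ) (i : Fin (m + 1))
    (hrw : ∀ k : M.K, M.r i k ≤ (w k.1.1 : EReal)) (hw : M.UniformlyIntegrable w)
    (h : UpperSemicontinuous (M.r i) ∨
      (∀ s D, MeasurableSet D → Continuous fun a : M.act s => M.p ⟨(s, a.1), a.2⟩ D) ∧
        ∀ s, UpperSemicontinuous fun a : M.act s => M.r i ⟨(s, a.1), a.2⟩) :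
    (∀ P ∈ M.strategicMeasures, M.Jpos i P < ⊤ ∧ M.J i P < ⊤) ∧
      UpperSemicontinuousOn (M.J i) M.strategicMeasures := by
  constructor
  · obtain ⟨l, hl⟩ := hw.exists_forall_discountedTotal_excess_le hrw one_ne_zero
    intro P hP
    have excess_ne_top := ((hl P hP).trans_lt ENNReal.one_lt_top).ne
    exact ⟨CMDP.Jpos_lt_top excess_ne_top, CMDP.J_lt_top excess_ne_top⟩
  · refine upperSemicontinuousOn_of_uniform_approx fun ε hε => ?_
    obtain ⟨l, hl⟩ := hw.exists_forall_discountedTotal_excess_le hrw (ENNReal.ofReal_pos.2 hε).ne'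
    have := CMDP.exists_upperSemicontinuousOn_approx_J
      (CMDP.lowerSemicontinuousOn_discountedTotal_shortfall h l) ENNReal.ofReal_ne_top hl
    rwa [EReal.coe_ennreal_ofReal, max_eq_left hε.le] at this

theorem lemma2 {S : Type u} {A : Type v}
    [TopologicalSpace S] [MeasurableSpace S] [BorelSubspaceOfPolish S]
    [TopologicalSpace A] [MeasurableSpace A] [BorelSubspaceOfPolish A]
    {m : ℕ} (M : CMDP S A m) (w : S → ℝ)
    (hA1 : M.IsUpperBound w) (hA2 : M.UniformlyIntegrable w)
    (hWS : M.IsWeaklyContinuous ∨ M.IsSetwiseContinuous) (i : Fin (m + 1)) :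
    (∀ P ∈ M.strategicMeasures, M.Jpos i P < ⊤ ∧ M.J i P < ⊤) ∧
      UpperSemicontinuousOn (M.J i) M.strategicMeasures :=
  lemma2_general M w i (hA1.r_le i) hA2
    (hWS.imp (fun h => h.usc_r i) fun h => ⟨h.continuous_p, h.usc_r i⟩)
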